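/- A planar convex body is a compact convex subset $K$ of the Euclidean plane with more than one point (line segments are allowed). Let $D(K)$ be its diameter, $r(K)$ its inradius (the largest radius of a disc contained in $K$), and $p(K)$ its perimeter, i.e. the length of the boundary of $K$ if $K$ has interior points, and twice the length of $K$ if $K$ is a segment. Let $e_1=(1,0)$ and let $\mathbb B$ be the closed unit disc centred at the origin. (a) For every planar convex body $K$ with $r(K)>0$, $$\frac{p(K)}{r(K)}\;\ge\;4\left(\frac{\pi}{2}-\arctan\sqrt{\frac{D(K)^2}{4r(K)^2}-1}+\sqrt{\frac{D(K)^2}{4r(K)^2}-1}\right),\qquad(*)$$ and if $r(K)=0$, then $p(K)\ge 2D(K)$ (the form that $(*)$, multiplied by $r(K)$, takes in the limit $r(K)\to 0$). (b) For every $r\in[0,1]$ the set $K_r=\mathrm{conv}([-e_1,e_1]\cup r\mathbb B)$ is a planar convex body with $r(K_r)=r$ and $D(K_r)=2$, and it attains equality in (a): in $(*)$ if $r>0$, and in $p\ge 2D$ if $r=0$. (c) Consequently these inequalities give the lower boundary of the $(p,D,r)$ diagram $\{(r(K)/D(K),\,p(K)/D(K)) : K \text{ a planar convex body}\}$. That is,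 the set of first coordinates of the diagram is $[0,\tfrac12]$; for every $x\in(0,\tfrac12]$ the least $y$ with $(x,y)$ in the diagram is $$4x\left(\frac{\pi}{2}-\arctan\sqrt{\frac{1}{4x^2}-1}+\sqrt{\frac{1}{4x^2}-1}\right);$$ and for $x=0$ the least such $y$ is $2$. -/

import Mathlib

open MeasureTheory

/-- The Euclidean plane. -/
abbrev Plane : Type := EuclideanSpace ℝ (Fin 2)

/-- The planar convex bodies: compact convex subsets of the plane with more than one point.
Line segments are allowed. -/
def planarBodies : Set (ConvexBody Plane) :=
  {K | (K : Set Plane).Nontrivial}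

/-- The diameter `D(K)`. -/
noncomputable def diameter (K : ConvexBody Plane) : ℝ :=
  Metric.diam (K : Set Plane)

/-- The inradius `r(K)`: the largest radius of a closed Euclidean disc contained in `K`
(a disc of radius `0` is a point, so a segment has inradius `0`). -/
noncomputable def inradius (K : ConvexBody Plane) : ℝ :=
  sSup {ρ : ℝ | 0 ≤ ρ ∧ ∃ c : Plane, Metric.closedBall c ρ ⊆ (K : Set Plane)}

open scoped Classical in
/-- The perimeter `p(K)`: the length (one-dimensional Hausdorff measure) of the boundary of `K` if
`K` has interior points. A body without interior points is a segment, regarded as a degenerate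
closed curve that is run through twice, and its perimeter is twice its length. -/
noncomputable def perimeter (K : ConvexBody Plane) : ℝ :=
  if (interior (K : Set Plane)).Nonempty then
    (Measure.hausdorffMeasure 1 (frontier (K : Set Plane))).toReal
  else
    2 * (Measure.hausdorffMeasure 1 (K : Set Plane)).toReal

/-- The first vector `e₁` of the canonical basis. -/
noncomputable def e₁ : Plane := EuclideanSpace.single 0 1

/-- The set `conv([-e₁, e₁] ∪ r𝔹)`, where `𝔹` is the closed unit disc. -/
noncomputable def doubleCap (r : ℝ) : Set Plane :=
  convexHull ℝ (segment ℝ (-e₁) e₁ ∪ Metric.closedBall (0 : Plane) r)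

/-- The `(p, D, r)` diagram: all points `(r(K) / D(K), p(K) / D(K))`, for planar convex
bodies `K`. -/
noncomputable def diagramPDr : Set (ℝ × ℝ) :=
  (fun K : ConvexBody Plane => (inradius K / diameter K, perimeter K / diameter K)) '' planarBodies

/-! By Cauchy's formula the perimeter is the integral of the width over the directions θ ∈ [0, π].
The width of K in direction θ is at least 2r, because K contains discs of radius arbitrarily close
to r, and at least |⟪x - y, dir θ⟫| for a diametral pair x, y. The integral of the maximum of these
two bounds depends only on r and D = ‖x - y‖, and it is bounded below by r times the right-hand side
of (*) (`le_integral_max_abs_inner_dir`). Only one half of Cauchy's formula is needed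
(`integral_le_length_frontier`): the boundary is a Lipschitz closed curve, inscribed polygons are no
longer than it, and closed polygons are handled edge by edge through ∫ |⟪v, dir θ⟫| = 2‖v‖. If r =
0, then K has no interior points, and its length is at least that of a diametral segment.

For equality it suffices to bound the perimeter of `doubleCap r` from above, since the general
inequality gives the reverse. Its boundary is covered by two circular arcs and four tangent segments
(`frontier_doubleCap_subset`), whose lengths add up to the required value. These bodies have D = 2
and r ∈ [0, 1], so r/D runs through [0, 1/2], and p/D = (r/D)(p/r) transfers the bound to the
diagram. -/

open scoped RealInnerProductSpace Topology NNReal ENNReal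

/-! ### Unit vectors and polar coordinates -/

/-- The unit vector with polar angle `θ`. -/
noncomputable def dir (θ : ℝ) : Plane := !₂[Real.cos θ, Real.sin θ]

@[simp] lemma dir_zero_coord (θ : ℝ) : dir θ 0 = Real.cos θ := rfl

@[simp] lemma dir_one_coord (θ : ℝ) : dir θ 1 = Real.sin θ := rfl

lemma inner_plane (x y : Plane) : ⟪x, y⟫ = x 0 * y 0 + x 1 * y 1 := by
  simp [PiLp.inner_apply, Fin.sum_univ_two, mul_comm]

lemma inner_dir (x : Plane) (θ : ℝ) : ⟪x, dir θ⟫ = x 0 * Real.cos θ + x 1 * Real.sin θ := by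
  simp [inner_plane]

lemma inner_dir_dir (α θ : ℝ) : ⟪dir α, dir θ⟫ = Real.cos (θ - α) := by
  rw [inner_dir, Real.cos_sub]; simp; ring

lemma norm_dir (θ : ℝ) : ‖dir θ‖ = 1 := by
  have h : ‖dir θ‖ ^ 2 = 1 := by
    rw [← real_inner_self_eq_norm_sq, inner_dir_dir]; simp
  nlinarith [norm_nonneg (dir θ)]

lemma dir_ne_zero (θ : ℝ) : dir θ ≠ 0 := by
  intro h
  have := norm_dir θ
  simp [h] at this

lemma dir_add_two_pi (θ : ℝ) : dir (θ + 2 * Real.pi) = dir θ := by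
  simp [dir]

lemma dir_add_pi (θ : ℝ) : dir (θ + Real.pi) = -dir θ := by
  ext i; fin_cases i <;> simp [dir]

lemma norm_dir_sub_dir_le (a b : ℝ) : ‖dir a - dir b‖ ≤ |a - b| := by
  have h : ‖dir a - dir b‖ ^ 2 = 2 - 2 * Real.cos (a - b) := by
    rw [norm_sub_sq_real, norm_dir, norm_dir, inner_dir_dir, ← Real.cos_neg]; ring_nf
  apply abs_le_of_sq_le_sq' _ (abs_nonneg _) |>.2
  rw [h, sq_abs]
  linarith [Real.one_sub_sq_div_two_le_cos (x := a - b)]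

lemma lipschitzWith_dir : LipschitzWith 1 dir :=
  LipschitzWith.of_dist_le_mul fun a b => by
    simpa [dist_eq_norm] using norm_dir_sub_dir_le a b

lemma continuous_dir : Continuous dir := lipschitzWith_dir.continuous

/-- Polar coordinates in the plane. -/
lemma exists_eq_norm_smul_dir (v : Plane) : ∃ α : ℝ, v = ‖v‖ • dir α := by
  let z : ℂ := ⟨v 0, v 1⟩
  have hz : ‖z‖ = ‖v‖ := by
    rw [EuclideanSpace.norm_eq, Complex.norm_eq_sqrt_sq_add_sq]
    simp [Fin.sum_univ_two, z]
  have h0 : v 0 = ‖z‖ * Real.cos z.arg := (Complex.norm_mul_cos_arg z).symm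
  have h1 : v 1 = ‖z‖ * Real.sin z.arg := (Complex.norm_mul_sin_arg z).symm
  rw [hz] at h0 h1
  refine ⟨z.arg, ?_⟩
  ext i
  fin_cases i
  · simpa using h0
  · simpa using h1

lemma injOn_dir : Set.InjOn dir (Set.Ico 0 (2 * Real.pi)) := by
  intro a ha b hb h
  have h0 : Real.cos a = Real.cos b := by simpa using congrArg (fun v : Plane => v 0) h
  have h1 : Real.sin a = Real.sin b := by simpa using congrArg (fun v : Plane => v 1) h
  have hang := Real.Angle.cos_sin_inj h0 h1
  obtain ⟨k, hk⟩ := Real.Angle.angle_eq_iff_two_pi_dvd_sub.1 hang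
  have hpi := Real.pi_pos
  have h1 : (k : ℝ) < 1 := by nlinarith [ha.1, ha.2, hb.1, hb.2]
  have h2 : (-1 : ℝ) < k := by nlinarith [ha.1, ha.2, hb.1, hb.2]
  have : k = 0 := by
    have h3 : k < 1 := by exact_mod_cast h1
    have h4 : -1 < k := by exact_mod_cast h2
    omega
  simp [this] at hk
  linarith

/-! ### Integrals over all directions -/

/-- |cos| has period π, so the interval can be moved to the one where cos is nonnegative. -/
lemma integral_comp_abs_cos_sub (F : ℝ → ℝ) (α : ℝ) :
    ∫ θ in (0 : ℝ)..Real.pi, F |Real.cos (θ - α)| =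
      ∫ θ in (-(Real.pi / 2))..(Real.pi / 2), F (Real.cos θ) := by
  rw [intervalIntegral.integral_comp_sub_right (fun θ => F |Real.cos θ|) α]
  have hper : Function.Periodic (fun θ => F |Real.cos θ|) Real.pi := by
    intro θ; simp
  have h := hper.intervalIntegral_add_eq (0 - α) (-(Real.pi / 2))
  rw [show 0 - α + Real.pi = Real.pi - α by ring,
    show -(Real.pi / 2) + Real.pi = Real.pi / 2 by ring] at h
  rw [h]
  refine intervalIntegral.integral_congr fun θ hθ => ?_
  rw [Set.uIcc_of_le (by linarith [Real.pi_pos])] at hθ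
  rw [abs_of_nonneg (Real.cos_nonneg_of_mem_Icc hθ)]

lemma integral_comp_abs_inner_dir (F : ℝ → ℝ) (v : Plane) :
    ∫ θ in (0 : ℝ)..Real.pi, F |⟪v, dir θ⟫| =
      ∫ θ in (-(Real.pi / 2))..(Real.pi / 2), F (‖v‖ * Real.cos θ) := by
  obtain ⟨α, hα⟩ := exists_eq_norm_smul_dir v
  rw [← integral_comp_abs_cos_sub (fun t => F (‖v‖ * t)) α]
  congr 1
  ext θ
  conv_lhs => rw [hα]
  rw [real_inner_smul_left, inner_dir_dir, abs_mul, abs_norm]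

/-- This turns lengths of projections back into lengths, and is the source of Cauchy's formula. -/
lemma integral_abs_inner_dir (v : Plane) :
    ∫ θ in (0 : ℝ)..Real.pi, |⟪v, dir θ⟫| = 2 * ‖v‖ := by
  have h := integral_comp_abs_inner_dir id v
  simp only [id] at h
  rw [h, intervalIntegral.integral_const_mul, integral_cos]
  simp; ring

lemma continuous_abs_inner_dir (v : Plane) : Continuous fun θ => |⟪v, dir θ⟫| :=
  (continuous_const.inner continuous_dir).abs

/-- The integral of the width of the convex hull of a disc and a segment is at least the value
obtained when the disc and the segment are concentric. -/
lemma le_integral_max_abs_inner_dir {r : ℝ} {v : Plane} (hr : 0 ≤ r) (hv : v ≠ 0) :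
    4 * (r * (Real.pi / 2 - Real.arccos (2 * r / ‖v‖)) +
        ‖v‖ / 2 * √(1 - (2 * r / ‖v‖) ^ 2)) ≤
      ∫ θ in (0 : ℝ)..Real.pi, max (2 * r) |⟪v, dir θ⟫| := by
  have hv' : 0 < ‖v‖ := norm_pos_iff.2 hv
  rw [integral_comp_abs_inner_dir (fun t => max (2 * r) t) v]
  set x := 2 * r / ‖v‖ with hx
  have hx0 : 0 ≤ x := by positivity
  -- At ±a the two competitors ‖v‖ cos θ and 2r agree when x ≤ 1; for x > 1 the junk value a = 0
  -- leaves only the constant 2r, and the square root below is 0 as well.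
  set a := Real.arccos x with ha
  have ha0 : 0 ≤ a := Real.arccos_nonneg _
  have ha1 : a ≤ Real.pi / 2 := Real.arccos_le_pi_div_two.2 hx0
  have hc : Continuous fun θ => max (2 * r) (‖v‖ * Real.cos θ) := by fun_prop
  have hI : ∀ s t : ℝ, IntervalIntegrable (fun θ => max (2 * r) (‖v‖ * Real.cos θ)) volume s t :=
    fun s t => hc.intervalIntegrable s t
  rw [← intervalIntegral.integral_add_adjacent_intervals (hI _ (-a)) (hI _ _),
    ← intervalIntegral.integral_add_adjacent_intervals (hI (-a) a) (hI _ _)]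
  have h1 : ∫ _ in (-(Real.pi / 2))..(-a), 2 * r ≤
      ∫ θ in (-(Real.pi / 2))..(-a), max (2 * r) (‖v‖ * Real.cos θ) :=
    intervalIntegral.integral_mono_on (by linarith) (by simp) (hI _ _)
      fun θ _ => le_max_left _ _
  have h3 : ∫ _ in a..(Real.pi / 2), 2 * r ≤
      ∫ θ in a..(Real.pi / 2), max (2 * r) (‖v‖ * Real.cos θ) :=
    intervalIntegral.integral_mono_on (by linarith) (by simp) (hI _ _)
      fun θ _ => le_max_left _ _
  have h2 : ∫ θ in (-a)..a, ‖v‖ * Real.cos θ ≤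
      ∫ θ in (-a)..a, max (2 * r) (‖v‖ * Real.cos θ) :=
    intervalIntegral.integral_mono_on (by linarith)
      ((by fun_prop : Continuous fun θ => ‖v‖ * Real.cos θ).intervalIntegrable _ _) (hI _ _)
      fun θ _ => le_max_right _ _
  rw [intervalIntegral.integral_const_mul, integral_cos, Real.sin_neg, ha, Real.sin_arccos] at h2
  rw [intervalIntegral.integral_const, smul_eq_mul] at h1 h3
  linarith

/-! ### Closed curves, inscribed polygons and Cauchy's inequality -/

/-- A closed walk covers the gap between two of its values once on the way out and once on the way
back. -/
lemma two_mul_abs_sub_le_sum_of_closed {n : ℕ} {g : ℕ → ℝ} (hg : g n = g 0) {i j : ℕ}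
    (hi : i ≤ n) (hj : j ≤ n) :
    2 * |g i - g j| ≤ ∑ k ∈ Finset.range n, |g (k + 1) - g k| := by
  wlog hij : i ≤ j generalizing i j
  · rw [abs_sub_comm]; exact this hj hi (le_of_not_ge hij)
  have h1 := dist_le_Ico_sum_dist g (Nat.zero_le i)
  have h2 := dist_le_Ico_sum_dist g hij
  have h3 := dist_le_Ico_sum_dist g hj
  have h4 : ∑ k ∈ Finset.range n, |g (k + 1) - g k| =
      ∑ k ∈ Finset.Ico 0 n, dist (g k) (g (k + 1)) := by
    simp [Real.dist_eq, abs_sub_comm]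
  rw [h4, ← Finset.sum_Ico_consecutive _ (Nat.zero_le j) hj,
    ← Finset.sum_Ico_consecutive _ (Nat.zero_le i) hij]
  rw [Real.dist_eq] at h1 h2 h3
  rw [hg] at h3
  have := abs_sub_le (g i) (g 0) (g j)
  rw [abs_sub_comm (g 0) (g i)] at h1
  rw [abs_sub_comm (g j) (g 0)] at h3
  linarith

/-- The curve is θ ↦ dir θ / gauge K (dir θ), since the boundary is the level set gauge = 1. The
gauge is Lipschitz because 0 is interior, and boundedness of K keeps it away from 0 on the unit
circle, so its reciprocal is Lipschitz there too. -/
lemma exists_radial_curve_of_mem_nhds_zero {K : Set Plane} (hK : Convex ℝ K) (hKc : IsCompact K)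
    (h0 : K ∈ 𝓝 0) :
    ∃ γ : ℝ → Plane, (∃ L : ℝ≥0, LipschitzWith L γ) ∧ Function.Periodic γ (2 * Real.pi) ∧
      Set.InjOn γ (Set.Ico 0 (2 * Real.pi)) ∧ Set.range γ = frontier K := by
  obtain ⟨L, hL⟩ := hK.lipschitz_gauge h0
  obtain ⟨R, hR0, hR⟩ := hKc.isBounded.subset_closedBall_lt 0 0
  have hle : ∀ θ, (gauge K (dir θ))⁻¹ ≤ R := fun θ => by
    have h := le_gauge_of_subset_closedBall (absorbent_nhds_zero h0) hR0.le hR (x := dir θ)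
    rw [norm_dir, one_div] at h
    exact inv_le_of_inv_le₀ hR0 h
  have hpos : ∀ θ, 0 < gauge K (dir θ) := fun θ =>
    (gauge_pos (absorbent_nhds_zero h0)
      ((NormedSpace.isVonNBounded_iff ℝ).2 hKc.isBounded)).2 (dir_ne_zero θ)
  refine ⟨fun θ => (gauge K (dir θ))⁻¹ • dir θ, ⟨(R * R * L + R).toNNReal, ?_⟩, ?_, ?_, ?_⟩
  · refine LipschitzWith.of_dist_le_mul fun a b => ?_
    rw [Real.coe_toNNReal _ (by positivity), dist_eq_norm, Real.dist_eq]
    have h1 : (gauge K (dir a))⁻¹ • dir a - (gauge K (dir b))⁻¹ • dir b =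
        ((gauge K (dir a))⁻¹ - (gauge K (dir b))⁻¹) • dir a +
          (gauge K (dir b))⁻¹ • (dir a - dir b) := by module
    rw [h1]
    refine (norm_add_le _ _).trans ?_
    rw [norm_smul, norm_smul, norm_dir, mul_one, Real.norm_eq_abs, Real.norm_eq_abs,
      abs_of_pos (inv_pos.2 (hpos b)), add_mul]
    have h2 : |gauge K (dir b) - gauge K (dir a)| ≤ L * |a - b| := by
      have h := hL.dist_le_mul (dir b) (dir a)
      rw [Real.dist_eq, dist_eq_norm] at h
      refine h.trans (mul_le_mul_of_nonneg_left ?_ L.2)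
      rw [abs_sub_comm]; exact norm_dir_sub_dir_le b a
    refine add_le_add ?_ (mul_le_mul (hle b) (norm_dir_sub_dir_le a b) (norm_nonneg _) hR0.le)
    rw [inv_sub_inv (hpos a).ne' (hpos b).ne', div_eq_mul_inv, mul_inv, abs_mul,
      abs_of_pos (mul_pos (inv_pos.2 (hpos a)) (inv_pos.2 (hpos b)))]
    have h3 : (gauge K (dir a))⁻¹ * (gauge K (dir b))⁻¹ ≤ R * R :=
      mul_le_mul (hle a) (hle b) (inv_pos.2 (hpos b)).le hR0.le
    calc _ ≤ (L * |a - b|) * (R * R) :=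
          mul_le_mul h2 h3 (mul_pos (inv_pos.2 (hpos a)) (inv_pos.2 (hpos b))).le (by positivity)
      _ = _ := by ring
  · intro θ
    simp only [dir_add_two_pi]
  · intro a ha b hb hab
    simp only at hab
    have hn := congrArg norm hab
    rw [norm_smul, norm_smul, norm_dir, norm_dir, mul_one, mul_one, Real.norm_eq_abs,
      Real.norm_eq_abs, abs_of_pos (inv_pos.2 (hpos a)), abs_of_pos (inv_pos.2 (hpos b))] at hn
    rw [hn] at hab
    exact injOn_dir ha hb (smul_right_injective _ (inv_pos.2 (hpos b)).ne' hab)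
  · ext v
    rw [← gauge_eq_one_iff_mem_frontier hK h0]
    constructor
    · rintro ⟨θ, rfl⟩
      simp only
      rw [gauge_smul_of_nonneg (inv_pos.2 (hpos θ)).le, smul_eq_mul, inv_mul_cancel₀ (hpos θ).ne']
    · intro hv
      obtain ⟨α, hα⟩ := exists_eq_norm_smul_dir v
      refine ⟨α, ?_⟩
      rw [hα, gauge_smul_of_nonneg (norm_nonneg _), smul_eq_mul] at hv
      simp only
      rw [← eq_inv_of_mul_eq_one_left hv]
      exact hα.symm

/-- The boundary of a planar convex body with interior points is a Lipschitz simple closed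
curve. -/
lemma exists_radial_curve {K : Set Plane} (hK : Convex ℝ K) (hKc : IsCompact K)
    (hi : (interior K).Nonempty) :
    ∃ γ : ℝ → Plane, (∃ L : ℝ≥0, LipschitzWith L γ) ∧ Function.Periodic γ (2 * Real.pi) ∧
      Set.InjOn γ (Set.Ico 0 (2 * Real.pi)) ∧ Set.range γ = frontier K := by
  obtain ⟨c, hc⟩ := hi
  let e : Plane ≃ₜ Plane := Homeomorph.addLeft c
  obtain ⟨γ, ⟨L, hL⟩, hper, hinj, hr⟩ := exists_radial_curve_of_mem_nhds_zero
    (K := e ⁻¹' K) (hK.translate_preimage_right c) (e.isCompact_preimage.2 hKc)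
    (e.continuous.continuousAt.preimage_mem_nhds (by simpa [e] using mem_interior_iff_mem_nhds.1 hc))
  refine ⟨fun θ => c + γ θ, ⟨L, ?_⟩, fun θ => ?_, fun a ha b hb hab => ?_, ?_⟩
  · exact LipschitzWith.of_dist_le_mul fun a b => by
      simpa using hL.dist_le_mul a b
  · simp only [hper θ]
  · exact hinj ha hb (add_left_cancel hab)
  · rw [← e.preimage_frontier] at hr
    have h : Set.range (fun θ => c + γ θ) = e '' Set.range γ := by
      rw [← Set.range_comp]; rfl
    rw [h, hr, Set.image_preimage_eq _ e.surjective]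

/-- A curve is at least as long as its chord. -/
lemma norm_sub_le_hausdorffMeasure_image {γ : ℝ → Plane} (hγ : Continuous γ) {a b : ℝ} (hab : a ≤ b) :
    ENNReal.ofReal ‖γ b - γ a‖ ≤ μH[1] (γ '' Set.Ico a b) := by
  -- Project onto the direction of the chord: this does not increase length, and by the intermediate
  -- value theorem the image covers an interval as long as the chord.
  obtain ⟨α, hα⟩ := exists_eq_norm_smul_dir (γ b - γ a)
  let f : Plane → ℝ := fun v => ⟪v, dir α⟫
  have hf : LipschitzWith 1 f := LipschitzWith.of_dist_le_mul fun v w => by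
    simp only [f, ← inner_sub_left, dist_eq_norm, NNReal.coe_one, one_mul]
    simpa [norm_dir] using abs_real_inner_le_norm (v - w) (dir α)
  have h1 := hf.hausdorffMeasure_image_le (zero_le_one' ℝ) (γ '' Set.Ico a b)
  simp only [ENNReal.coe_one, ENNReal.one_rpow, one_mul] at h1
  refine le_trans ?_ h1
  rw [← Set.image_comp, hausdorffMeasure_real]
  have h2 := intermediate_value_Ico hab ((hf.continuous.comp hγ).continuousOn)
  refine le_trans (le_of_eq ?_) (measure_mono h2)
  rw [Real.volume_Ico]
  congr 1
  simp only [f, Function.comp, ← inner_sub_left]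
  conv_rhs => rw [hα]
  rw [real_inner_smul_left, inner_dir_dir]
  simp

/-- A simple closed curve is at least as long as an inscribed polygon. -/
lemma sum_norm_sub_le_hausdorffMeasure {γ : ℝ → Plane} (hγ : Continuous γ) {T : ℝ} (hT : 0 ≤ T)
    (hinj : Set.InjOn γ (Set.Ico 0 T)) (n : ℕ) :
    ENNReal.ofReal (∑ k ∈ Finset.range n,
      ‖γ (T * ((k + 1 : ℕ) / n : ℝ)) - γ (T * (k / n : ℝ))‖) ≤ μH[1] (Set.range γ) := by
  rw [ENNReal.ofReal_sum_of_nonneg fun _ _ => norm_nonneg _]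
  let t : ℕ → ℝ := fun k => T * (k / n : ℝ)
  have ht : Monotone t := fun i j hij => by
    simp only [t]; gcongr
  have hsub : ∀ k ∈ Finset.range n, Set.Ico (t k) (t (k + 1)) ⊆ Set.Ico 0 T := by
    intro k hk
    have hk' := Finset.mem_range.1 hk
    have hn : (n : ℝ) ≠ 0 := by
      have : n ≠ 0 := by omega
      exact_mod_cast this
    have h1 := ht (Nat.zero_le k)
    have h2 := ht (Nat.succ_le_of_lt hk')
    have h3 : t 0 = 0 := by simp [t]
    have h4 : t n = T := by simp [t, hn]
    exact Set.Ico_subset_Ico (h3 ▸ h1) (h4 ▸ h2)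
  calc _ ≤ ∑ k ∈ Finset.range n, μH[1] (γ '' Set.Ico (t k) (t (k + 1))) :=
        Finset.sum_le_sum fun k _ => norm_sub_le_hausdorffMeasure_image hγ (ht (Nat.le_succ k))
    _ = μH[1] (⋃ k ∈ Finset.range n, γ '' Set.Ico (t k) (t (k + 1))) := by
        -- Half-open parameter intervals and injectivity on one period make the arcs disjoint, so
        -- their measures add exactly.
        refine (measure_biUnion_finset ?_ ?_).symm
        · intro i hi j hj hij
          refine Set.disjoint_image_image fun x hx y hy hxy => ?_
          have := hinj (hsub i hi hx) (hsub j hj hy) hxy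
          subst this
          exact Set.disjoint_left.1 (ht.pairwise_disjoint_on_Ico_succ hij) hx hy
        · intro k hk
          exact measurableSet_Ico.image_of_continuousOn_injOn hγ.continuousOn
            (hinj.mono (hsub k hk))
    _ ≤ _ := measure_mono (Set.iUnion₂_subset fun k _ => Set.image_subset_range _ _)

lemma hausdorffMeasure_range_lt_top {γ : ℝ → Plane} {L : ℝ≥0} (hγ : LipschitzWith L γ) {T : ℝ}
    (hT : 0 < T) (hper : Function.Periodic γ T) : μH[1] (Set.range γ) < ⊤ := by
  rw [← hper.image_Icc hT 0]
  refine (hγ.hausdorffMeasure_image_le zero_le_one _).trans_lt ?_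
  rw [hausdorffMeasure_real, Real.volume_Icc]
  exact ENNReal.mul_lt_top (by simp) ENNReal.ofReal_lt_top

/-- In each direction the projected closed polygon has length at least 2 w θ. Integrating over θ
turns each projected edge into twice its length, and the factors 2 cancel. -/
lemma integral_le_sum_norm_of_closed {n : ℕ} {P : ℕ → Plane} (hP : P n = P 0) {w : ℝ → ℝ}
    (hw : Continuous w)
    (h : ∀ θ, ∃ i ≤ n, ∃ j ≤ n, w θ ≤ |⟪P i - P j, dir θ⟫|) :
    ∫ θ in (0 : ℝ)..Real.pi, w θ ≤ ∑ k ∈ Finset.range n, ‖P (k + 1) - P k‖ := by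
  have hI : ∀ k ∈ Finset.range n, IntervalIntegrable (fun θ => |⟪P (k + 1) - P k, dir θ⟫|)
      volume 0 Real.pi := fun k _ => (continuous_abs_inner_dir _).intervalIntegrable _ _
  have h1 : ∫ θ in (0 : ℝ)..Real.pi, 2 * w θ ≤
      ∫ θ in (0 : ℝ)..Real.pi, ∑ k ∈ Finset.range n, |⟪P (k + 1) - P k, dir θ⟫| := by
    refine intervalIntegral.integral_mono_on Real.pi_pos.le
      ((continuous_const.mul hw).intervalIntegrable _ _)
      ((continuous_finsetSum _ fun k _ => continuous_abs_inner_dir _).intervalIntegrable _ _)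
      fun θ _ => ?_
    obtain ⟨i, hi, j, hj, hij⟩ := h θ
    have := two_mul_abs_sub_le_sum_of_closed (g := fun k => ⟪P k, dir θ⟫) (by simp [hP]) hi hj
    simp only [← inner_sub_left] at this
    linarith
  rw [intervalIntegral.integral_finsetSum hI, intervalIntegral.integral_const_mul] at h1
  simp only [integral_abs_inner_dir, ← Finset.mul_sum] at h1
  linarith

/-- One half of Cauchy's formula: the length of the boundary is at least the integral of any
continuous minorant of the width function. -/
lemma integral_le_length_frontier {K : Set Plane} (hK : Convex ℝ K) (hKc : IsCompact K)
    (hi : (interior K).Nonempty) {w : ℝ → ℝ} (hw : Continuous w)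
    (h : ∀ θ, ∃ p ∈ frontier K, ∃ q ∈ frontier K, w θ ≤ ⟪p - q, dir θ⟫) :
    ∫ θ in (0 : ℝ)..Real.pi, w θ ≤ (μH[1] (frontier K)).toReal := by
  obtain ⟨γ, ⟨L, hL⟩, hper, hinj, hr⟩ := exists_radial_curve hK hKc hi
  have hT : 0 < 2 * Real.pi := Real.two_pi_pos
  have hfin : μH[1] (frontier K) ≠ ⊤ := by
    rw [← hr]; exact (hausdorffMeasure_range_lt_top hL hT hper).ne
  have hn : ∀ n : ℕ, 0 < n →
      ∫ θ in (0 : ℝ)..Real.pi, w θ ≤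
        (μH[1] (frontier K)).toReal + 2 * L * (2 * Real.pi) * Real.pi * (1 / n : ℝ) := by
    intro n hn
    have hn' : (0 : ℝ) < n := by exact_mod_cast hn
    -- The parameter mesh is 2π/n, so every boundary point lies within ε of a vertex of the
    -- inscribed n-gon.
    set ε : ℝ := L * (2 * Real.pi * (1 / n)) with hε
    let P : ℕ → Plane := fun k => γ (2 * Real.pi * (k / n : ℝ))
    have hPn : P n = P 0 := by
      have := hper 0
      simp only [zero_add] at this
      simp [P, hn'.ne', this]
    have happ : ∀ p ∈ frontier K, ∃ i ≤ n, ‖p - P i‖ ≤ ε := by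
      intro p hp
      rw [← hr] at hp
      obtain ⟨x, rfl⟩ := hp
      obtain ⟨y, hy, hxy⟩ := hper.exists_mem_Ico₀ hT x
      set z := y / (2 * Real.pi) * n with hz
      have hz0 : 0 ≤ z := by have := hy.1; positivity
      have hzn : z ≤ n := by
        have : y / (2 * Real.pi) ≤ 1 := (div_le_one hT).2 hy.2.le
        nlinarith
      refine ⟨⌊z⌋₊, by exact_mod_cast (Nat.floor_le hz0).trans hzn, ?_⟩
      rw [hxy, ← dist_eq_norm]
      refine (hL.dist_le_mul _ _).trans (mul_le_mul_of_nonneg_left ?_ L.2)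
      have hyz : y = 2 * Real.pi * (z / n) := by rw [hz]; field_simp
      rw [Real.dist_eq, hyz, ← mul_sub, abs_mul, abs_of_pos hT, ← sub_div, abs_div,
        abs_of_pos hn', abs_of_nonneg (sub_nonneg.2 (Nat.floor_le hz0))]
      have := Nat.lt_floor_add_one z
      gcongr
      linarith
    have hdir : ∀ (v : Plane) θ, ⟪v, dir θ⟫ ≤ ‖v‖ := fun v θ => by
      simpa [norm_dir] using real_inner_le_norm v (dir θ)
    -- Replacing p and q by nearby vertices costs ε each; the total loss 2επ vanishes as n → ∞.
    have h1 := integral_le_sum_norm_of_closed hPn (w := fun θ => w θ - 2 * ε)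
      (hw.sub continuous_const) fun θ => by
        obtain ⟨p, hp, q, hq, hpq⟩ := h θ
        obtain ⟨i, hi, hpi⟩ := happ p hp
        obtain ⟨j, hj, hqj⟩ := happ q hq
        refine ⟨i, hi, j, hj, le_trans ?_ (le_abs_self _)⟩
        have e : p - q = (p - P i) + (P i - P j) + (P j - q) := by abel
        have h2 := hdir (p - P i) θ
        have h3 := hdir (P j - q) θ
        rw [norm_sub_rev] at h3
        rw [e, inner_add_left, inner_add_left] at hpq
        linarith
    have h2 := sum_norm_sub_le_hausdorffMeasure hL.continuous hT.le hinj n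
    rw [hr, ENNReal.ofReal_le_iff_le_toReal hfin] at h2
    have h3 := h1.trans h2
    rw [intervalIntegral.integral_sub (hw.intervalIntegrable _ _) (by simp),
      intervalIntegral.integral_const, smul_eq_mul, sub_zero, hε] at h3
    linarith
  have hlim : Filter.Tendsto (fun n : ℕ => (μH[1] (frontier K)).toReal +
      2 * L * (2 * Real.pi) * Real.pi * (1 / n : ℝ)) Filter.atTop
      (𝓝 (μH[1] (frontier K)).toReal) := by
    simpa using (tendsto_one_div_atTop_nhds_zero_nat.const_mul
      (2 * L * (2 * Real.pi) * Real.pi)).const_add (μH[1] (frontier K)).toReal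
  exact ge_of_tendsto hlim (Filter.eventually_atTop.2 ⟨1, fun n h => hn n h⟩)

/-! ### Support points, diameter and inradius -/

/-- A maximum point cannot be interior, because a small step along dir θ would increase the
functional. -/
lemma exists_mem_frontier_isMaxOn_inner {K : Set Plane} (hK : IsCompact K) (hne : K.Nonempty)
    (θ : ℝ) : ∃ p ∈ frontier K, ∀ y ∈ K, ⟪y, dir θ⟫ ≤ ⟪p, dir θ⟫ := by
  have hc : Continuous fun y : Plane => ⟪y, dir θ⟫ := by fun_prop
  obtain ⟨p, hp, hmax⟩ := hK.exists_isMaxOn hne hc.continuousOn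
  refine ⟨p, ⟨subset_closure hp, fun hpi => ?_⟩, fun y hy => hmax hy⟩
  obtain ⟨ε, hε, hball⟩ := Metric.nhds_basis_closedBall.mem_iff.1 (mem_interior_iff_mem_nhds.1 hpi)
  have hmem : p + ε • dir θ ∈ K := hball (by simp [norm_smul, norm_dir, abs_of_pos hε])
  have h := hmax hmem
  simp only [Set.mem_ofPred_eq, inner_add_left, real_inner_smul_left, inner_dir_dir, sub_self,
    Real.cos_zero] at h
  linarith

lemma exists_dist_eq_diameter (K : ConvexBody Plane) :
    ∃ x ∈ (K : Set Plane), ∃ y ∈ (K : Set Plane), dist x y = diameter K := by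
  have hc : Continuous fun z : Plane × Plane => dist z.1 z.2 := by fun_prop
  obtain ⟨z, hz, hmax⟩ := (K.isCompact.prod K.isCompact).exists_isMaxOn
    (K.nonempty.prod K.nonempty) hc.continuousOn
  rw [isMaxOn_iff] at hmax
  exact ⟨z.1, hz.1, z.2, hz.2, le_antisymm
    (Metric.dist_le_diam_of_mem K.isCompact.isBounded hz.1 hz.2)
    (Metric.diam_le_of_forall_dist_le dist_nonneg fun a ha b hb => hmax (a, b) ⟨ha, hb⟩)⟩

lemma diameter_pos {K : ConvexBody Plane} (hK : K ∈ planarBodies) : 0 < diameter K :=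
  Metric.diam_pos hK K.isCompact.isBounded

lemma add_smul_dir_mem_closedBall (c : Plane) {ρ : ℝ} (hρ : 0 ≤ ρ) (θ : ℝ) :
    c + ρ • dir θ ∈ Metric.closedBall c ρ := by
  simp [norm_smul, norm_dir, abs_of_nonneg hρ]

lemma sub_smul_dir_mem_closedBall (c : Plane) {ρ : ℝ} (hρ : 0 ≤ ρ) (θ : ℝ) :
    c - ρ • dir θ ∈ Metric.closedBall c ρ := by
  simp [norm_smul, norm_dir, abs_of_nonneg hρ]

lemma two_mul_le_inner_sub {K : Set Plane} {c p q : Plane} {ρ θ : ℝ} (hρ : 0 ≤ ρ)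
    (h : Metric.closedBall c ρ ⊆ K) (hp : ∀ y ∈ K, ⟪y, dir θ⟫ ≤ ⟪p, dir θ⟫)
    (hq : ∀ y ∈ K, ⟪q, dir θ⟫ ≤ ⟪y, dir θ⟫) : 2 * ρ ≤ ⟪p - q, dir θ⟫ := by
  have h1 := hp _ (h (add_smul_dir_mem_closedBall c hρ θ))
  have h2 := hq _ (h (sub_smul_dir_mem_closedBall c hρ θ))
  simp only [inner_add_left, inner_sub_left, real_inner_smul_left, inner_dir_dir, sub_self,
    Real.cos_zero] at h1 h2 ⊢
  linarith

lemma two_mul_le_diameter {K : ConvexBody Plane} {c : Plane} {ρ : ℝ} (hρ : 0 ≤ ρ)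
    (h : Metric.closedBall c ρ ⊆ (K : Set Plane)) : 2 * ρ ≤ diameter K := by
  have h1 := Metric.dist_le_diam_of_mem K.isCompact.isBounded
    (h (add_smul_dir_mem_closedBall c hρ 0)) (h (sub_smul_dir_mem_closedBall c hρ 0))
  refine le_trans (le_of_eq ?_) h1
  rw [dist_eq_norm, show c + ρ • dir 0 - (c - ρ • dir 0) = (2 * ρ) • dir 0 by module, norm_smul,
    norm_dir, Real.norm_eq_abs, abs_of_nonneg (by positivity), mul_one]

lemma inradius_set_nonempty (K : ConvexBody Plane) :
    {ρ : ℝ | 0 ≤ ρ ∧ ∃ c : Plane, Metric.closedBall c ρ ⊆ (K : Set Plane)}.Nonempty := by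
  obtain ⟨c, hc⟩ := K.nonempty
  exact ⟨0, le_rfl, c, by simpa using hc⟩

lemma le_inradius {K : ConvexBody Plane} {c : Plane} {ρ : ℝ} (hρ : 0 ≤ ρ)
    (h : Metric.closedBall c ρ ⊆ (K : Set Plane)) : ρ ≤ inradius K := by
  refine le_csSup ⟨diameter K / 2, ?_⟩ ⟨hρ, c, h⟩
  rintro σ ⟨hσ, d, hd⟩
  linarith [two_mul_le_diameter hσ hd]

lemma inradius_le {K : ConvexBody Plane} {b : ℝ}
    (h : ∀ ρ c, 0 ≤ ρ → Metric.closedBall c ρ ⊆ (K : Set Plane) → ρ ≤ b) : inradius K ≤ b :=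
  csSup_le (inradius_set_nonempty K) fun ρ ⟨hρ, c, hc⟩ => h ρ c hρ hc

lemma inradius_nonneg (K : ConvexBody Plane) : 0 ≤ inradius K := by
  obtain ⟨c, hc⟩ := K.nonempty
  exact le_inradius (c := c) le_rfl (by simpa using hc)

lemma two_mul_inradius_le_diameter (K : ConvexBody Plane) : 2 * inradius K ≤ diameter K := by
  have : inradius K ≤ diameter K / 2 := inradius_le fun ρ c hρ h => by
    linarith [two_mul_le_diameter hρ h]
  linarith

lemma inradius_pos_iff (K : ConvexBody Plane) :
    0 < inradius K ↔ (interior (K : Set Plane)).Nonempty := by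
  constructor
  · intro h
    obtain ⟨ρ, ⟨-, c, hc⟩, hpos⟩ := exists_lt_of_lt_csSup (inradius_set_nonempty K) h
    exact ⟨c, mem_interior_iff_mem_nhds.2
      (Filter.mem_of_superset (Metric.closedBall_mem_nhds c hpos) hc)⟩
  · rintro ⟨c, hc⟩
    obtain ⟨ε, hε, hball⟩ :=
      Metric.nhds_basis_closedBall.mem_iff.1 (mem_interior_iff_mem_nhds.1 hc)
    exact hε.trans_le (le_inradius hε.le hball)

/-! ### The lower bounds on the perimeter -/

/-- A convex set without interior points is collinear, hence lies in a bounded piece of a line.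
Finiteness matters because `toReal` sends ⊤ to 0 and is monotone only below ⊤. -/
lemma hausdorffMeasure_lt_top_of_interior_eq_empty {K : Set Plane} (hK : Convex ℝ K)
    (hKb : Bornology.IsBounded K) (hi : ¬ (interior K).Nonempty) : μH[1] K < ⊤ := by
  rcases K.eq_empty_or_nonempty with rfl | ⟨p, hp⟩
  · simp
  rw [hK.interior_nonempty_iff_affineSpan_eq_top] at hi
  have hcol : Collinear ℝ K := by
    rw [collinear_iff_finrank_le_one]
    by_contra! h
    have h2 : Module.finrank ℝ (vectorSpan ℝ K) = Module.finrank ℝ Plane :=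
      le_antisymm (Submodule.finrank_le _) (by rw [finrank_euclideanSpace_fin]; exact h)
    exact hi ((AffineSubspace.affineSpan_eq_top_iff_vectorSpan_eq_top_of_nonempty ℝ Plane Plane
      ⟨p, hp⟩).2 (Submodule.eq_top_of_finrank_eq h2))
  obtain ⟨v, hv⟩ := (collinear_iff_of_mem hp).1 hcol
  obtain ⟨R, hR⟩ := hKb.subset_closedBall p
  obtain ⟨α, hα⟩ := exists_eq_norm_smul_dir v
  have hsub : K ⊆ (fun t : ℝ => p + t • dir α) '' Set.Icc (-R) R := by
    intro y hy
    obtain ⟨t, rfl⟩ := hv y hy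
    have h1 := hR hy
    refine ⟨t * ‖v‖, ?_, ?_⟩
    · simpa [norm_smul, ← abs_le, abs_mul] using h1
    · simp only [mul_smul, ← hα, vadd_eq_add, add_comm]
  refine (measure_mono hsub).trans_lt ?_
  have hlip : LipschitzWith 1 fun t : ℝ => p + t • dir α :=
    LipschitzWith.of_dist_le_mul fun s t => by
      simp [dist_eq_norm, ← sub_smul, norm_smul, norm_dir]
  refine (hlip.hausdorffMeasure_image_le zero_le_one _).trans_lt ?_
  rw [hausdorffMeasure_real, Real.volume_Icc]
  exact ENNReal.mul_lt_top (by simp) ENNReal.ofReal_lt_top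

lemma two_mul_diameter_le_perimeter_of_inradius_eq_zero {K : ConvexBody Plane}
    (h : inradius K = 0) : 2 * diameter K ≤ perimeter K := by
  have hi : ¬ (interior (K : Set Plane)).Nonempty := by
    rw [← inradius_pos_iff, h]; exact lt_irrefl 0
  rw [perimeter, if_neg hi]
  obtain ⟨x, hx, y, hy, hxy⟩ := exists_dist_eq_diameter K
  have h1 : μH[1] (segment ℝ x y) ≤ μH[1] (K : Set Plane) :=
    measure_mono (K.convex.segment_subset hx hy)
  have h2 := ENNReal.toReal_mono
    (hausdorffMeasure_lt_top_of_interior_eq_empty K.convex K.isCompact.isBounded hi).ne h1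
  rw [hausdorffMeasure_segment, edist_dist, ENNReal.toReal_ofReal dist_nonneg, hxy] at h2
  linarith

/-- The lower bound on the perimeter in terms of diameter and inradius. -/
lemma le_perimeter {K : ConvexBody Plane} (hK : K ∈ planarBodies) (hr : 0 < inradius K) :
    4 * (inradius K * (Real.pi / 2 - Real.arccos (2 * inradius K / diameter K)) +
      diameter K / 2 * √(1 - (2 * inradius K / diameter K) ^ 2)) ≤ perimeter K := by
  have hi := (inradius_pos_iff K).1 hr
  rw [perimeter, if_pos hi]
  obtain ⟨x, hx, y, hy, hxy⟩ := exists_dist_eq_diameter K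
  rw [dist_eq_norm] at hxy
  have hne : x - y ≠ 0 := norm_pos_iff.1 (hxy ▸ diameter_pos hK)
  refine (hxy ▸ le_integral_max_abs_inner_dir hr.le hne).trans
    (integral_le_length_frontier K.convex K.isCompact hi
      (continuous_const.max (continuous_abs_inner_dir (x - y))) fun θ => ?_)
  obtain ⟨p, hpf, hp⟩ := exists_mem_frontier_isMaxOn_inner K.isCompact K.nonempty θ
  -- The minimum in direction θ is the maximum in the opposite direction.
  obtain ⟨q, hqf, hq'⟩ := exists_mem_frontier_isMaxOn_inner K.isCompact K.nonempty (θ + Real.pi)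
  have hq : ∀ z ∈ (K : Set Plane), ⟪q, dir θ⟫ ≤ ⟪z, dir θ⟫ := fun z hz => by
    simpa [dir_add_pi, inner_neg_right] using hq' z hz
  refine ⟨p, hpf, q, hqf, max_le ?_ (abs_le.2 ?_)⟩
  · have : inradius K ≤ ⟪p - q, dir θ⟫ / 2 := inradius_le fun ρ c hρ h => by
      linarith [two_mul_le_inner_sub hρ h hp hq]
    linarith
  · have h1 := hp x hx
    have h2 := hp y hy
    have h3 := hq x hx
    have h4 := hq y hy
    simp only [inner_sub_left]
    constructor <;> linarith

/-- If cos a = 2r/D, then tan a = √(D²/(4r²) - 1). Together with `mul_sqrt_one_sub` this converts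
the integral's value to the form (*). -/
lemma arccos_two_mul_div {r D : ℝ} (hr : 0 < r) (hD : 0 < D) :
    Real.arccos (2 * r / D) = Real.arctan √(D ^ 2 / (4 * r ^ 2) - 1) := by
  have hx : 0 < 2 * r / D := by positivity
  rw [Real.arccos_eq_arctan hx, ← Real.sqrt_sq hx.le, ← Real.sqrt_div' _ (sq_nonneg _),
    Real.sq_sqrt (sq_nonneg _)]
  congr 2
  field_simp
  ring

lemma mul_sqrt_one_sub {r D : ℝ} (hr : 0 < r) (hD : 0 < D) :
    D / 2 * √(1 - (2 * r / D) ^ 2) = r * √(D ^ 2 / (4 * r ^ 2) - 1) := by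
  have h1 : √((r * D⁻¹ * 2) ^ 2) = r * D⁻¹ * 2 := Real.sqrt_sq (by positivity)
  have h2 : 1 - (2 * r / D) ^ 2 = (r * D⁻¹ * 2) ^ 2 * (D ^ 2 / (4 * r ^ 2) - 1) := by
    field_simp
    ring
  rw [h2, Real.sqrt_mul (sq_nonneg _), h1]
  field_simp

lemma le_perimeter_arctan {K : ConvexBody Plane} (hK : K ∈ planarBodies) (hr : 0 < inradius K) :
    4 * (Real.pi / 2 - Real.arctan √(diameter K ^ 2 / (4 * inradius K ^ 2) - 1) +
      √(diameter K ^ 2 / (4 * inradius K ^ 2) - 1)) ≤ perimeter K / inradius K := by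
  have h := le_perimeter hK hr
  rw [arccos_two_mul_div hr (diameter_pos hK), mul_sqrt_one_sub hr (diameter_pos hK)] at h
  rw [le_div_iff₀ hr]
  linarith

/-! ### The extremal bodies: compactness, diameter and inradius -/

lemma e₁_eq_dir : e₁ = dir 0 := by
  ext i; fin_cases i <;> simp [e₁, dir]

lemma inner_e₁_dir (θ : ℝ) : ⟪e₁, dir θ⟫ = Real.cos θ := by
  simp [e₁_eq_dir, inner_dir_dir]

lemma norm_e₁ : ‖e₁‖ = 1 := by rw [e₁_eq_dir, norm_dir]

lemma norm_le_one_of_mem_segment {s : Plane} (hs : s ∈ segment ℝ (-e₁) e₁) : ‖s‖ ≤ 1 := by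
  have h := (convex_closedBall (0 : Plane) 1).segment_subset (x := -e₁) (y := e₁)
    (by simp [norm_e₁]) (by simp [norm_e₁]) hs
  simpa using h

lemma exists_smul_e₁_of_mem_segment {s : Plane} (hs : s ∈ segment ℝ (-e₁) e₁) :
    ∃ t : ℝ, |t| ≤ 1 ∧ s = t • e₁ := by
  obtain ⟨a, b, ha, hb, hab, rfl⟩ := hs
  refine ⟨b - a, abs_le.2 ⟨by linarith, by linarith⟩, by module⟩

lemma isCompact_segment (x y : Plane) : IsCompact (segment ℝ x y) := by
  rw [← convexHull_pair]
  exact (Set.toFinite {x, y}).isCompact_convexHull ℝ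

lemma isCompact_doubleCap (r : ℝ) : IsCompact (doubleCap r) := by
  rcases lt_or_ge r 0 with hr | hr
  · rw [doubleCap, Metric.closedBall_eq_empty.2 hr, Set.union_empty,
      (convex_segment _ _).convexHull_eq]
    exact isCompact_segment _ _
  have hc : Continuous fun p : (Plane × Plane) × ℝ => (1 - p.2) • p.1.1 + p.2 • p.1.2 := by
    fun_prop
  have h := (((isCompact_segment (-e₁) e₁).prod
    (isCompact_closedBall (0 : Plane) r)).prod (isCompact_Icc (a := (0 : ℝ)) (b := 1))).image hc
  convert h using 1
  -- The hull of two nonempty convex sets is their join, here a continuous image of a compact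
  -- product.
  rw [doubleCap, (convex_segment _ _).convexHull_union (convex_closedBall _ _)
    ⟨e₁, right_mem_segment ℝ _ _⟩ ⟨0, by simpa using hr⟩]
  ext x
  rw [mem_convexJoin]
  constructor
  · rintro ⟨s, hs, z, hz, a, b, ha, hb, hab, rfl⟩
    obtain rfl : a = 1 - b := by linarith
    exact ⟨((s, z), b), ⟨⟨hs, hz⟩, hb, by linarith⟩, rfl⟩
  · rintro ⟨p, ⟨⟨hs, hz⟩, hb⟩, rfl⟩
    exact ⟨_, hs, _, hz, 1 - p.2, p.2, by linarith [hb.2], hb.1, by ring, rfl⟩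

/-- The convex hull of the segment and the disc, as a convex body. -/
noncomputable def doubleCapBody (r : ℝ) : ConvexBody Plane where
  carrier := doubleCap r
  convex' := convex_convexHull ℝ _
  isCompact' := isCompact_doubleCap r
  nonempty' := ⟨e₁, subset_convexHull ℝ _ (Or.inl (right_mem_segment ℝ _ _))⟩

lemma coe_doubleCapBody (r : ℝ) : (doubleCapBody r : Set Plane) = doubleCap r := rfl

lemma e₁_mem_doubleCap (r : ℝ) : e₁ ∈ doubleCap r :=
  subset_convexHull ℝ _ (Or.inl (right_mem_segment ℝ _ _))

lemma neg_e₁_mem_doubleCap (r : ℝ) : -e₁ ∈ doubleCap r :=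
  subset_convexHull ℝ _ (Or.inl (left_mem_segment ℝ _ _))

lemma closedBall_subset_doubleCap (r : ℝ) : Metric.closedBall 0 r ⊆ doubleCap r :=
  fun _ hz => subset_convexHull ℝ _ (Or.inr hz)

lemma dist_neg_e₁_e₁ : dist (-e₁) e₁ = 2 := by
  rw [dist_eq_norm, show -e₁ - e₁ = (-2 : ℝ) • e₁ by module, norm_smul, norm_e₁]
  norm_num

lemma doubleCapBody_mem_planarBodies (r : ℝ) : doubleCapBody r ∈ planarBodies := by
  refine ⟨-e₁, neg_e₁_mem_doubleCap r, e₁, e₁_mem_doubleCap r, ?_⟩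
  rw [← dist_pos, dist_neg_e₁_e₁]
  norm_num

lemma diameter_doubleCapBody {r : ℝ} (hr : r ≤ 1) : diameter (doubleCapBody r) = 2 := by
  refine le_antisymm ?_ ?_
  · have hsub : doubleCap r ⊆ Metric.closedBall 0 1 := by
      refine convexHull_min (Set.union_subset (fun s hs => ?_) ?_) (convex_closedBall _ _)
      · simpa using norm_le_one_of_mem_segment hs
      · exact Metric.closedBall_subset_closedBall hr
    have h := (Metric.diam_mono hsub Metric.isBounded_closedBall).trans
      (Metric.diam_closedBall zero_le_one)
    simpa [diameter, coe_doubleCapBody] using h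
  · rw [← dist_neg_e₁_e₁]
    exact Metric.dist_le_diam_of_mem (doubleCapBody r).isCompact.isBounded
      (neg_e₁_mem_doubleCap r) (e₁_mem_doubleCap r)

lemma inradius_doubleCapBody {r : ℝ} (hr : 0 ≤ r) : inradius (doubleCapBody r) = r := by
  refine le_antisymm (inradius_le fun ρ c hρ h => ?_)
    (le_inradius hr (closedBall_subset_doubleCap r))
  -- The body lies in the horizontal strip of half-width r, which contains no larger disc.
  have hc : Convex ℝ {y : Plane | |⟪y, dir (Real.pi / 2)⟫| ≤ r} := by
    intro x hx y hy a b ha hb hab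
    simp only [Set.mem_ofPred_eq, abs_le, inner_add_left, real_inner_smul_left] at *
    constructor <;> nlinarith
  have hsub : doubleCap r ⊆ {y : Plane | |⟪y, dir (Real.pi / 2)⟫| ≤ r} := by
    refine convexHull_min (Set.union_subset (fun s hs => ?_) fun z hz => ?_) hc
    · obtain ⟨t, -, rfl⟩ := exists_smul_e₁_of_mem_segment hs
      simpa [real_inner_smul_left, inner_e₁_dir] using hr
    · refine (abs_real_inner_le_norm _ _).trans ?_
      simpa [norm_dir] using hz
  have h1 := hsub (h (add_smul_dir_mem_closedBall c hρ (Real.pi / 2)))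
  have h2 := hsub (h (sub_smul_dir_mem_closedBall c hρ (Real.pi / 2)))
  simp only [Set.mem_ofPred_eq, abs_le, inner_add_left, inner_sub_left, real_inner_smul_left, inner_dir_dir, sub_self,
    Real.cos_zero] at h1 h2
  linarith

/-! ### Boundary and perimeter of the extremal bodies -/

/-- A boundary point of a planar convex set with interior points has an outer normal. -/
lemma exists_normal_of_mem_frontier {K : Set Plane} (hK : Convex ℝ K)
    (hi : (interior K).Nonempty) {x : Plane} (hx : x ∈ frontier K) :
    ∃ θ : ℝ, ∀ y ∈ K, ⟪y, dir θ⟫ ≤ ⟪x, dir θ⟫ := by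
  obtain ⟨f, hf⟩ := geometric_hahn_banach_open_point hK.interior isOpen_interior hx.2
  set u := (InnerProductSpace.toDual ℝ Plane).symm f with hu
  have hfu : ∀ y, f y = ⟪y, u⟫ := fun y => by
    rw [real_inner_comm, hu, InnerProductSpace.toDual_symm_apply]
  obtain ⟨α, hα⟩ := exists_eq_norm_smul_dir u
  have hle : ∀ y ∈ K, f y ≤ f x := fun y hy => by
    have hcl : y ∈ closure (interior K) := by
      rw [hK.closure_interior_eq_closure_of_nonempty_interior hi]
      exact subset_closure hy
    exact closure_minimal (fun z hz => (hf z hz).le)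
      (isClosed_le f.continuous continuous_const) hcl
  have hupos : 0 < ‖u‖ := by
    obtain ⟨c, hc⟩ := hi
    have h := hf c hc
    rw [norm_pos_iff]
    intro h0
    simp [hfu, h0] at h
  refine ⟨α, fun y hy => ?_⟩
  have h := hle y hy
  rw [hfu, hfu, hα, real_inner_smul_right, real_inner_smul_right] at h
  exact le_of_mul_le_mul_left h hupos

/-- Equality case of Cauchy–Schwarz: ‖z - r dir θ‖² ≤ r² - 2r² + r² = 0. -/
lemma eq_smul_dir_of_norm_le {z : Plane} {r θ : ℝ} (hz : ‖z‖ ≤ r) (h : r ≤ ⟪z, dir θ⟫) :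
    z = r • dir θ := by
  rw [← sub_eq_zero, ← norm_eq_zero, ← sq_eq_zero_iff]
  refine le_antisymm ?_ (sq_nonneg _)
  rw [norm_sub_sq_real, real_inner_smul_right, norm_smul, norm_dir, mul_one, Real.norm_eq_abs,
    sq_abs]
  have := norm_nonneg z
  nlinarith

/-- The four tangent segments of the boundary of `doubleCap r`. -/
noncomputable def capSegment (r : ℝ) (σ τ : ℝ) : Set Plane :=
  segment ℝ (σ • e₁) (r • !₂[σ * r, τ * √(1 - r ^ 2)])

/-- The circular arc in the boundary of `doubleCap r` in the direction of `σ • (0, 1)`. -/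
noncomputable def capArc (r : ℝ) (σ : ℝ) : Set Plane :=
  (fun t => (σ * r) • dir t) '' Set.Icc (Real.arccos r) (Real.pi - Real.arccos r)

/-- If sin θ ≥ 0, the angle arccos (cos θ) represents the same direction. Otherwise this applies to
θ + π, as the lower arc is the reflection of the upper one through 0. -/
lemma smul_dir_mem_capArc {r θ : ℝ} (h : |Real.cos θ| ≤ r) :
    r • dir θ ∈ capArc r 1 ∪ capArc r (-1) := by
  have key : ∀ φ, |Real.cos φ| ≤ r → 0 ≤ Real.sin φ →
      ∃ t ∈ Set.Icc (Real.arccos r) (Real.pi - Real.arccos r), dir t = dir φ := by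
    intro φ hφ hs
    refine ⟨Real.arccos (Real.cos φ), ⟨Real.arccos_le_arccos (abs_le.1 hφ).2, ?_⟩, ?_⟩
    · rw [← Real.arccos_neg]
      exact Real.arccos_le_arccos (abs_le.1 hφ).1
    · ext i
      fin_cases i
      · simpa using Real.cos_arccos (Real.neg_one_le_cos φ) (Real.cos_le_one φ)
      · have : √(1 - Real.cos φ ^ 2) = Real.sin φ := by
          rw [← Real.sin_sq, Real.sqrt_sq hs]
        simpa [Real.sin_arccos] using this
  rcases le_total 0 (Real.sin θ) with hs | hs
  · obtain ⟨t, ht, hd⟩ := key θ h hs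
    exact Or.inl ⟨t, ht, by simp [hd]⟩
  · obtain ⟨t, ht, hd⟩ := key (θ + Real.pi) (by simpa using h) (by simpa using hs)
    exact Or.inr ⟨t, ht, by simp [hd, dir_add_pi]⟩

lemma segment_subset_capSegment {r θ σ : ℝ} (h : Real.cos θ = σ * r) (hσ : σ ^ 2 = 1) :
    segment ℝ (σ • e₁) (r • dir θ) ⊆ capSegment r σ 1 ∪ capSegment r σ (-1) := by
  have hs : 1 - r ^ 2 = Real.sin θ ^ 2 := by
    rw [Real.sin_sq, h, mul_pow, hσ, one_mul]
  rcases le_total 0 (Real.sin θ) with h0 | h0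
  · refine (Eq.subset ?_).trans Set.subset_union_left
    rw [capSegment, hs, Real.sqrt_sq h0, dir, h, one_mul]
  · refine (Eq.subset ?_).trans Set.subset_union_right
    rw [capSegment, hs, Real.sqrt_sq_eq_abs, abs_of_nonpos h0, dir, h]
    simp

lemma smul_e₁_mem_capSegment (r σ τ : ℝ) : σ • e₁ ∈ capSegment r σ τ := left_mem_segment ℝ _ _

/-- A nonconstant linear functional on a segment attains its maximum only at an endpoint. -/
lemma eq_smul_e₁_of_abs_cos_le {s : Plane} {θ : ℝ} (hs : s ∈ segment ℝ (-e₁) e₁)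
    (hc : 0 < |Real.cos θ|) (h : |Real.cos θ| ≤ ⟪s, dir θ⟫) :
    ∃ σ : ℝ, (σ = 1 ∨ σ = -1) ∧ s = σ • e₁ ∧ Real.cos θ = σ * |Real.cos θ| := by
  obtain ⟨t, ht, rfl⟩ := exists_smul_e₁_of_mem_segment hs
  rw [real_inner_smul_left, inner_e₁_dir] at h
  rw [abs_le] at ht
  rcases abs_cases (Real.cos θ) with ⟨h1, h2⟩ | ⟨h1, h2⟩
  · have : t = 1 := by rw [h1] at hc h; nlinarith
    exact ⟨1, Or.inl rfl, by rw [this], by rw [h1]; ring⟩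
  · have : t = -1 := by rw [h1] at hc h; nlinarith
    exact ⟨-1, Or.inr rfl, by rw [this], by rw [h1]; ring⟩

/-- Write x = a s + (1 - a) z with s in the segment and z in the disc, and take an outer normal dir
θ at x. The support values are |cos θ| and r, and x attains the larger one, so each of s, z with
positive weight attains it too. Hence x lies on an arc (a = 0), is an endpoint ±e₁ (a = 1), or else
|cos θ| = r and x lies on a tangent segment. -/
lemma frontier_doubleCap_subset {r : ℝ} (hr : 0 < r) :
    frontier (doubleCap r) ⊆ (capArc r 1 ∪ capArc r (-1)) ∪
      ((capSegment r 1 1 ∪ capSegment r 1 (-1)) ∪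
        (capSegment r (-1) 1 ∪ capSegment r (-1) (-1))) := by
  intro x hx
  have hK : Convex ℝ (doubleCap r) := convex_convexHull ℝ _
  have hi : (interior (doubleCap r)).Nonempty := ⟨0, mem_interior_iff_mem_nhds.2
    (Filter.mem_of_superset (Metric.closedBall_mem_nhds 0 hr) (closedBall_subset_doubleCap r))⟩
  obtain ⟨θ, hθ⟩ := exists_normal_of_mem_frontier hK hi hx
  have hxK : x ∈ doubleCap r := (doubleCapBody r).isCompact.isClosed.frontier_subset hx
  have hxr : r ≤ ⟪x, dir θ⟫ := by
    have h := hθ _ (closedBall_subset_doubleCap r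
      (by simpa using add_smul_dir_mem_closedBall 0 hr.le θ) : r • dir θ ∈ doubleCap r)
    simpa [real_inner_smul_left, norm_dir] using h
  have hxc : |Real.cos θ| ≤ ⟪x, dir θ⟫ := by
    have h1 := hθ _ (e₁_mem_doubleCap r)
    have h2 := hθ _ (neg_e₁_mem_doubleCap r)
    rw [inner_neg_left, inner_e₁_dir] at h2
    rw [inner_e₁_dir] at h1
    exact abs_le'.2 ⟨h1, h2⟩
  rw [doubleCap, (convex_segment _ _).convexHull_union (convex_closedBall _ _)
    ⟨e₁, right_mem_segment ℝ _ _⟩ ⟨0, by simpa using hr.le⟩, mem_convexJoin] at hxK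
  obtain ⟨s, hs, z, hz, a, b, ha, hb, hab, rfl⟩ := hxK
  have hz' : ‖z‖ ≤ r := by simpa using hz
  have hsc : ⟪s, dir θ⟫ ≤ |Real.cos θ| := by
    obtain ⟨t, ht, rfl⟩ := exists_smul_e₁_of_mem_segment hs
    rw [real_inner_smul_left, inner_e₁_dir]
    refine (le_abs_self _).trans ?_
    rw [abs_mul]
    exact mul_le_of_le_one_left (abs_nonneg _) ht
  have hzr : ⟪z, dir θ⟫ ≤ r := by
    have := real_inner_le_norm z (dir θ)
    rw [norm_dir, mul_one] at this
    exact this.trans hz'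
  rw [inner_add_left, real_inner_smul_left, real_inner_smul_left] at hxr hxc
  obtain rfl : b = 1 - a := by linarith
  have hend : 0 < a → r ≤ |Real.cos θ| ∧ |Real.cos θ| ≤ ⟪s, dir θ⟫ := fun h => by
    have h1 : r ≤ ⟪s, dir θ⟫ := by nlinarith
    refine ⟨h1.trans hsc, ?_⟩
    nlinarith
  have hball : 0 < 1 - a → |Real.cos θ| ≤ r ∧ z = r • dir θ := fun h => by
    have h1 : |Real.cos θ| ≤ ⟪z, dir θ⟫ := by nlinarith
    exact ⟨h1.trans hzr, eq_smul_dir_of_norm_le hz' (by nlinarith)⟩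
  rcases ha.eq_or_lt with rfl | ha
  · obtain ⟨h1, rfl⟩ := hball (by norm_num)
    left
    simpa using smul_dir_mem_capArc h1
  obtain ⟨h1, h2⟩ := hend ha
  obtain ⟨σ, hσ, rfl, hcos⟩ := eq_smul_e₁_of_abs_cos_le hs (hr.trans_le h1) h2
  right
  have hmem : a • σ • e₁ + (1 - a) • z ∈ capSegment r σ 1 ∪ capSegment r σ (-1) := by
    rcases hb.eq_or_lt with hb | hb
    · obtain rfl : a = 1 := by linarith
      left
      simpa using smul_e₁_mem_capSegment r σ 1
    · obtain ⟨h3, rfl⟩ := hball hb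
      rw [le_antisymm h3 h1] at hcos
      exact segment_subset_capSegment hcos (by rcases hσ with rfl | rfl <;> norm_num)
        ⟨a, 1 - a, ha.le, hb.le, by ring, rfl⟩
  rcases hσ with rfl | rfl
  · exact Or.inl hmem
  · exact Or.inr hmem

lemma hausdorffMeasure_capArc_le {r σ : ℝ} (hr : 0 ≤ r) (hσ : |σ| = 1) :
    μH[1] (capArc r σ) ≤ ENNReal.ofReal (r * (Real.pi - 2 * Real.arccos r)) := by
  have hlip : LipschitzWith r.toNNReal fun t => (σ * r) • dir t := by
    refine LipschitzWith.of_dist_le_mul fun s t => ?_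
    rw [dist_eq_norm, ← smul_sub, norm_smul, Real.norm_eq_abs, abs_mul, hσ, one_mul,
      abs_of_nonneg hr, Real.coe_toNNReal _ hr, Real.dist_eq]
    exact mul_le_mul_of_nonneg_left (norm_dir_sub_dir_le s t) hr
  refine (hlip.hausdorffMeasure_image_le zero_le_one _).trans ?_
  rw [hausdorffMeasure_real, Real.volume_Icc, ENNReal.rpow_one, ENNReal.ofReal_mul hr]
  refine mul_le_mul_right (ENNReal.ofReal_le_ofReal (le_of_eq ?_)) _
  ring

/-- Pythagoras: the tangent from ±e₁ is a leg of a right triangle with hypotenuse 1 and other leg r.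
-/
lemma hausdorffMeasure_capSegment {r σ τ : ℝ} (hr0 : 0 ≤ r) (hr : r ≤ 1) (hσ : σ ^ 2 = 1)
    (hτ : τ ^ 2 = 1) : μH[1] (capSegment r σ τ) = ENNReal.ofReal √(1 - r ^ 2) := by
  have h1 : 0 ≤ 1 - r ^ 2 := by nlinarith
  have h2 := Real.sq_sqrt h1
  rw [capSegment, hausdorffMeasure_segment, edist_dist, EuclideanSpace.dist_eq]
  congr 2
  simp [e₁, Fin.sum_univ_two, Real.dist_eq, sq_abs]
  linear_combination (1 - 2 * r ^ 2 + r ^ 4) * hσ + r ^ 2 * τ ^ 2 * h2 + r ^ 2 * (1 - r ^ 2) * hτ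

/-- Subadditivity over the six pieces suffices; the reverse inequality is an instance of
`le_perimeter`. -/
lemma perimeter_doubleCapBody_le {r : ℝ} (hr : 0 < r) (hr1 : r ≤ 1) :
    perimeter (doubleCapBody r) ≤
      4 * (r * (Real.pi / 2 - Real.arccos r) + √(1 - r ^ 2)) := by
  have hi : (interior (doubleCapBody r : Set Plane)).Nonempty :=
    (inradius_pos_iff _).1 (by rwa [inradius_doubleCapBody hr.le])
  rw [perimeter, if_pos hi, coe_doubleCapBody]
  have harc : 0 ≤ r * (Real.pi - 2 * Real.arccos r) := by
    have := Real.arccos_le_pi_div_two.2 hr.le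
    exact mul_nonneg hr.le (by linarith)
  have hA := fun σ (hσ : |σ| = 1) => hausdorffMeasure_capArc_le hr.le hσ
  have hS := fun σ τ (hσ : σ ^ 2 = 1) (hτ : τ ^ 2 = 1) =>
    (hausdorffMeasure_capSegment hr.le hr1 hσ hτ).le
  have hq := Real.sqrt_nonneg (1 - r ^ 2)
  have h : μH[1] (frontier (doubleCap r)) ≤
      ENNReal.ofReal ((r * (Real.pi - 2 * Real.arccos r) + r * (Real.pi - 2 * Real.arccos r)) +
        ((√(1 - r ^ 2) + √(1 - r ^ 2)) + (√(1 - r ^ 2) + √(1 - r ^ 2)))) := by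
    refine (measure_mono (frontier_doubleCap_subset hr)).trans ?_
    rw [ENNReal.ofReal_add (by positivity) (by positivity), ENNReal.ofReal_add harc harc,
      ENNReal.ofReal_add (by positivity) (by positivity), ENNReal.ofReal_add hq hq]
    refine (measure_union_le _ _).trans (add_le_add ((measure_union_le _ _).trans
      (add_le_add (hA 1 (by simp)) (hA (-1) (by simp)))) ?_)
    refine (measure_union_le _ _).trans (add_le_add ?_ ?_)
    · exact (measure_union_le _ _).trans (add_le_add (hS _ _ (by norm_num) (by norm_num))
        (hS _ _ (by norm_num) (by norm_num)))
    · exact (measure_union_le _ _).trans (add_le_add (hS _ _ (by norm_num) (by norm_num))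
        (hS _ _ (by norm_num) (by norm_num)))
  refine (ENNReal.toReal_le_of_le_ofReal (by positivity) h).trans (le_of_eq ?_)
  ring

lemma perimeter_div_inradius_doubleCapBody {r : ℝ} (hr : 0 < r) (hr1 : r ≤ 1) :
    perimeter (doubleCapBody r) / inradius (doubleCapBody r) =
      4 * (Real.pi / 2 - Real.arctan √(diameter (doubleCapBody r) ^ 2 /
          (4 * inradius (doubleCapBody r) ^ 2) - 1) +
        √(diameter (doubleCapBody r) ^ 2 / (4 * inradius (doubleCapBody r) ^ 2) - 1)) := by
  have hrad := inradius_doubleCapBody hr.le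
  refine le_antisymm ?_
    (le_perimeter_arctan (doubleCapBody_mem_planarBodies r) (by rwa [hrad]))
  have h := perimeter_doubleCapBody_le hr hr1
  have h1 := arccos_two_mul_div hr two_pos
  have h2 := mul_sqrt_one_sub hr two_pos
  rw [mul_div_cancel_left₀ r two_ne_zero] at h1 h2
  rw [div_self two_ne_zero, one_mul] at h2
  rw [h1, h2] at h
  rw [hrad, diameter_doubleCapBody hr1, div_le_iff₀ hr]
  linarith

lemma perimeter_doubleCapBody_zero : perimeter (doubleCapBody 0) = 4 := by
  have hi : ¬ (interior (doubleCapBody 0 : Set Plane)).Nonempty := by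
    rw [← inradius_pos_iff, inradius_doubleCapBody le_rfl]
    exact lt_irrefl 0
  have h0 : (0 : Plane) ∈ segment ℝ (-e₁) e₁ :=
    ⟨1 / 2, 1 / 2, by norm_num, by norm_num, by norm_num, by simp⟩
  have hd : doubleCap 0 = segment ℝ (-e₁) e₁ := by
    rw [doubleCap, Metric.closedBall_zero,
      Set.union_eq_self_of_subset_right (Set.singleton_subset_iff.2 h0),
      (convex_segment _ _).convexHull_eq]
  rw [perimeter, if_neg hi, coe_doubleCapBody, hd, hausdorffMeasure_segment, edist_dist,
    dist_neg_e₁_e₁, ENNReal.toReal_ofReal zero_le_two]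
  norm_num

/-! ### The lower boundary of the diagram -/

lemma mem_diagramPDr_iff {x y : ℝ} : (x, y) ∈ diagramPDr ↔
    ∃ K ∈ planarBodies, inradius K / diameter K = x ∧ perimeter K / diameter K = y := by
  simp [diagramPDr]

/-- The parameter 2x compensates for the diameter 2. -/
lemma inradius_div_diameter_doubleCapBody {x : ℝ} (hx0 : 0 ≤ x) (hx : x ≤ 1 / 2) :
    inradius (doubleCapBody (2 * x)) / diameter (doubleCapBody (2 * x)) = x := by
  rw [inradius_doubleCapBody (by linarith), diameter_doubleCapBody (by linarith)]
  ring

lemma fst_image_diagramPDr : Prod.fst '' diagramPDr = Set.Icc (0 : ℝ) (1 / 2) := by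
  ext x
  constructor
  · rintro ⟨-, ⟨K, hK, rfl⟩, rfl⟩
    have hD := diameter_pos hK
    have h := two_mul_inradius_le_diameter K
    exact ⟨div_nonneg (inradius_nonneg K) hD.le, by
      simp only; rw [div_le_iff₀ hD]; linarith⟩
  · rintro ⟨h0, h1⟩
    exact ⟨_, ⟨_, doubleCapBody_mem_planarBodies (2 * x), rfl⟩,
      inradius_div_diameter_doubleCapBody h0 h1⟩

lemma perimeter_div_diameter_eq {K : ConvexBody Plane} {x : ℝ} (hr : 0 < inradius K)
    (hx : inradius K / diameter K = x) :
    perimeter K / diameter K = x * (perimeter K / inradius K) := by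
  rw [← hx]
  field_simp

lemma diameter_sq_div_eq {r D x : ℝ} (hx : r / D = x) :
    D ^ 2 / (4 * r ^ 2) = 1 / (4 * x ^ 2) := by
  rw [← hx, div_pow, mul_div_assoc', one_div_div]

lemma isLeast_diagramPDr {x : ℝ} (hx : x ∈ Set.Ioc (0 : ℝ) (1 / 2)) :
    IsLeast {y : ℝ | (x, y) ∈ diagramPDr}
      (4 * x * (Real.pi / 2 - Real.arctan (√(1 / (4 * x ^ 2) - 1)) +
        √(1 / (4 * x ^ 2) - 1))) := by
  obtain ⟨hx0, hx1⟩ := hx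
  constructor
  · have hx' := inradius_div_diameter_doubleCapBody hx0.le hx1
    have hr : 0 < inradius (doubleCapBody (2 * x)) := by
      rw [inradius_doubleCapBody (by linarith)]; linarith
    refine mem_diagramPDr_iff.2 ⟨_, doubleCapBody_mem_planarBodies (2 * x), hx', ?_⟩
    rw [perimeter_div_diameter_eq hr hx',
      perimeter_div_inradius_doubleCapBody (by linarith) (by linarith), diameter_sq_div_eq hx']
    ring
  · intro y hy
    obtain ⟨K, hK, hxK, rfl⟩ := mem_diagramPDr_iff.1 hy
    have hr : 0 < inradius K := (inradius_nonneg K).lt_of_ne fun h => by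
      rw [← h, zero_div] at hxK
      exact hx0.ne hxK
    have h := mul_le_mul_of_nonneg_left (le_perimeter_arctan hK hr) hx0.le
    rw [← perimeter_div_diameter_eq hr hxK, diameter_sq_div_eq hxK] at h
    linarith

lemma isLeast_diagramPDr_zero : IsLeast {y : ℝ | ((0 : ℝ), y) ∈ diagramPDr} 2 := by
  constructor
  · refine mem_diagramPDr_iff.2 ⟨_, doubleCapBody_mem_planarBodies 0, ?_, ?_⟩
    · rw [inradius_doubleCapBody le_rfl, zero_div]
    · rw [perimeter_doubleCapBody_zero, diameter_doubleCapBody zero_le_one]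
      norm_num
  · intro y hy
    obtain ⟨K, hK, hxK, rfl⟩ := mem_diagramPDr_iff.1 hy
    have hD := diameter_pos hK
    rw [le_div_iff₀ hD]
    exact two_mul_diameter_le_perimeter_of_inradius_eq_zero
      ((div_eq_zero_iff.1 hxK).resolve_right hD.ne')

theorem mainTheorem3 :
    -- the inequality, for bodies with interior points and for segments
    (∀ K ∈ planarBodies,
      (0 < inradius K →
        perimeter K / inradius K ≥
          4 * (Real.pi / 2 - Real.arctan (√(diameter K ^ 2 / (4 * inradius K ^ 2) - 1))
            + √(diameter K ^ 2 / (4 * inradius K ^ 2) - 1))) ∧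
      (inradius K = 0 → perimeter K ≥ 2 * diameter K)) ∧
    -- equality
    (∀ r ∈ Set.Icc (0 : ℝ) 1, ∃ K ∈ planarBodies,
      (K : Set Plane) = doubleCap r ∧ inradius K = r ∧ diameter K = 2 ∧
      (0 < r →
        perimeter K / inradius K =
          4 * (Real.pi / 2 - Real.arctan (√(diameter K ^ 2 / (4 * inradius K ^ 2) - 1))
            + √(diameter K ^ 2 / (4 * inradius K ^ 2) - 1))) ∧
      (r = 0 → perimeter K = 2 * diameter K)) ∧
    -- the lower boundary of the diagram
    Prod.fst '' diagramPDr = Set.Icc (0 : ℝ) (1 / 2) ∧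
    (∀ x ∈ Set.Ioc (0 : ℝ) (1 / 2),
      IsLeast {y : ℝ | (x, y) ∈ diagramPDr}
        (4 * x * (Real.pi / 2 - Real.arctan (√(1 / (4 * x ^ 2) - 1))
          + √(1 / (4 * x ^ 2) - 1)))) ∧
    IsLeast {y : ℝ | ((0 : ℝ), y) ∈ diagramPDr} 2 := by
  refine ⟨fun K hK => ⟨le_perimeter_arctan hK,
    two_mul_diameter_le_perimeter_of_inradius_eq_zero⟩, fun r hr => ?_, fst_image_diagramPDr,
    fun x hx => isLeast_diagramPDr hx, isLeast_diagramPDr_zero⟩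
  refine ⟨doubleCapBody r, doubleCapBody_mem_planarBodies r, coe_doubleCapBody r,
    inradius_doubleCapBody hr.1, diameter_doubleCapBody hr.2,
    fun h => perimeter_div_inradius_doubleCapBody h hr.2, ?_⟩
  rintro rfl
  rw [perimeter_doubleCapBody_zero, diameter_doubleCapBody zero_le_one]
  norm_num
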